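/- Let $\Gamma$ be a graph and let $G\le \mathrm{Aut}(\Gamma)$. A $2$-arc of $\Gamma$ is a triple $(u,v,w)$ of pairwise distinct vertices with $u\sim v\sim w$, and $\Gamma$ is $(G,2)$-arc-transitive if $G$ is transitive on the set of all $2$-arcs of $\Gamma$. For $N\trianglelefteq G$, the normal quotient $\Gamma_N$ is the graph whose vertices are the $N$-orbits on the vertices of $\Gamma$, two distinct orbits being adjacent if and only if some vertex of one is adjacent in $\Gamma$ to some vertex of the other. A graph $\Gamma$ is called a $2$-arc-transitive non-solvable minimal cover of a graph $\Sigma$ if there are a group $G\le\mathrm{Aut}(\Gamma)$ and a non-solvable minimal normal subgroup $N$ of $G$ (the transformation group of the cover) such that $\Gamma$ is $(G,2)$-arc-transitive, $N$ has at least three orbits on the vertices of $\Gamma$, $\Gamma_N\cong\Sigma$, and for each vertex $v$ the projection $\Gamma\to\Gamma_N$ maps the neighbours of $v$ bijectively onto the neighbours of the image of $v$. **Corollary 1.3.** There exist infinitely many pairwise non-isomorphic finite connected graphs that are $2$-arc-transitive non-solvable minimal covers of the Petersen graph. -/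

import Mathlib

/-- The Petersen graph: vertices are the 2-element subsets of a 5-element set, two of them being
adjacent if and only if they are disjoint. -/
def petersenGraph : SimpleGraph {a : Finset (Fin 5) // a.card = 2} where
  Adj a b := Disjoint a.1 b.1
  symm := ⟨fun _ _ h => h.symm⟩
  loopless := ⟨fun a h => by
    have h0 : a.1 = ∅ := by simpa using h
    have h2 := a.2
    rw [h0] at h2
    simp at h2⟩

namespace SimpleGraph

/-- A sequence of `s + 1` vertices is an `s`-arc if any two consecutive terms are adjacent and any
three consecutive terms are distinct (adjacent terms being distinct anyway, this means that terms
at distance two in the sequence are distinct). -/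
def IsSArc {V : Type*} (Γ : SimpleGraph V) (s : ℕ) (x : Fin (s + 1) → V) : Prop :=
  (∀ i j : Fin (s + 1), (j : ℕ) = (i : ℕ) + 1 → Γ.Adj (x i) (x j)) ∧
    ∀ i j : Fin (s + 1), (j : ℕ) = (i : ℕ) + 2 → x i ≠ x j

/-- `Γ` is `(G, s)`-arc-transitive: the group `G` of automorphisms of `Γ` is transitive on the set
of all `s`-arcs of `Γ`. -/
def IsSArcTransitive {V : Type*} (Γ : SimpleGraph V) (G : Subgroup (Γ ≃g Γ)) (s : ℕ) : Prop :=
  ∀ x y : Fin (s + 1) → V, Γ.IsSArc s x → Γ.IsSArc s y → ∃ g ∈ G, ∀ i, g (x i) = y i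

/-- The normal quotient `Γ_N`: its vertices are the `N`-orbits on the vertices of `Γ`, and two
distinct orbits are adjacent if and only if some vertex of the first is adjacent in `Γ` to some
vertex of the second. -/
def normalQuotient {V : Type*} (Γ : SimpleGraph V) {G : Subgroup (Γ ≃g Γ)} (N : Subgroup G) :
    SimpleGraph (MulAction.orbitRel.Quotient N V) :=
  Γ.map (Quotient.mk (MulAction.orbitRel N V))

/-- `Γ` is an `N`-cover of `Δ`, where `N` is a normal subgroup of a group `G` of automorphisms of
`Γ`: the vertex set has at least three `N`-orbits, the normal quotient `Γ_N` is isomorphic to `Δ`,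
and the projection of `Γ` onto `Γ_N` maps the neighbours of each vertex bijectively
onto the neighbours of its image. The group `N` is the transformation group of the cover. -/
structure IsNormalCover {V W : Type*} (Γ : SimpleGraph V) (Δ : SimpleGraph W)
    (G : Subgroup (Γ ≃g Γ)) (N : Subgroup G) : Prop where
  normal : N.Normal
  three_le_orbits : 3 ≤ ENat.card (MulAction.orbitRel.Quotient N V)
  quotient_iso : Nonempty (Γ.normalQuotient N ≃g Δ)
  bijOn_neighborSet : ∀ v : V, Set.BijOn (Quotient.mk (MulAction.orbitRel N V))
    (Γ.neighborSet v) ((Γ.normalQuotient N).neighborSet (Quotient.mk (MulAction.orbitRel N V) v))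

end SimpleGraph

/-- `N` is a minimal normal subgroup of `X`. -/
structure Subgroup.IsMinimalNormal {X : Type*} [Group X] (N : Subgroup X) : Prop where
  normal : N.Normal
  ne_bot : N ≠ ⊥
  eq_of_le : ∀ M : Subgroup X, M.Normal → M ≤ N → M ≠ ⊥ → M = N

/-- `Γ` is an `s`-arc-transitive non-solvable minimal cover of `Δ`: for some group `G` of
automorphisms of `Γ` and some non-solvable minimal normal subgroup `N` of `G`, the graph `Γ` is
`(G, s)`-arc-transitive and is an `N`-cover of `Δ`. -/
def SimpleGraph.IsNonsolvableMinimalCover {V W : Type*} (Γ : SimpleGraph V) (Δ : SimpleGraph W)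
    (s : ℕ) : Prop :=
  ∃ (G : Subgroup (Γ ≃g Γ)) (N : Subgroup G), Γ.IsSArcTransitive G s ∧
    Γ.IsNormalCover Δ G N ∧ N.IsMinimalNormal ∧ ¬ Group.IsSolvable N

/-! The group A₅ acts 2-arc-transitively on the Petersen graph and contains involutions `rotA`,
`rotB`, `rotC`: the first two generate the S₃ fixing a vertex, and the third reverses an edge and
commutes with `rotB`. Let `a`, `b`, `c` in a finite non-abelian simple group T satisfy the same
local relations. In T × A₅ the pairs `(a, rotA)`, `(b, rotB)` generate a copy L of S₃, and `(c,
rotC)` defines an orbital graph on the cosets of L. The factor T acts freely with the Petersen graph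
as quotient, and 2-arc-transitivity lifts (`isOrbitalCover_petersen`).

Connectedness requires the three pairs to generate a group containing T × 1. Since `rotA * rotC` has
order 5, that group contains `((a * c) ^ 5, 1)`, so it suffices that this element and conjugation by
`b` yield T.

For T = PSL(2, p) with p ≡ 1 mod 4 and p > 5, a square root of -1 gives explicit matrices with `a *
c` a transvection and `b` exchanging upper and lower ones. The covers have at least p vertices, so
infinitely many orders occur. -/

theorem MonoidHom.range_isMinimalNormal {T X : Type*} [Group T] [IsSimpleGroup T] [Group X]
    (f : T →* X) (hn : f.range.Normal) (hf : Function.Injective f) :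
    f.range.IsMinimalNormal where
  normal := hn
  ne_bot h := by
    obtain ⟨t, ht⟩ := exists_ne (1 : T)
    have : f t ∈ f.range := ⟨t, rfl⟩
    rw [h, Subgroup.mem_bot] at this
    exact ht (hf (this.trans f.map_one.symm))
  eq_of_le M hM hle hne := by
    rcases (hM.comap f).eq_bot_or_eq_top with h | h
    · refine absurd ((Subgroup.eq_bot_iff_forall M).2 fun m hm => ?_) hne
      obtain ⟨t, rfl⟩ := hle hm
      have ht : t ∈ M.comap f := hm
      rw [h, Subgroup.mem_bot] at ht
      rw [ht, map_one]
    · refine le_antisymm hle ?_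
      rintro _ ⟨t, rfl⟩
      have ht : t ∈ M.comap f := h ▸ Subgroup.mem_top t
      exact ht

/-! ### Orbital graphs as normal covers -/

namespace SimpleGraph

variable {T G V W : Type*} [Group T] [Group G] [MulAction G V] [MulAction G W]

/-- The orbital graph of a pair of distinct points that some group element interchanges. -/
def orbitalGraph (G : Type*) [Group G] [MulAction G V] (x y : V) (hxy : x ≠ y)
    (hs : ∃ c : G, c • x = y ∧ c • y = x) : SimpleGraph V where
  Adj u v := ∃ g : G, g • x = u ∧ g • y = v
  symm := ⟨fun u v h => by
    obtain ⟨g, rfl, rfl⟩ := h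
    obtain ⟨c, hc, hc'⟩ := hs
    exact ⟨g * c, by rw [mul_smul, hc], by rw [mul_smul, hc']⟩⟩
  loopless := ⟨fun u h => by
    obtain ⟨g, h1, h2⟩ := h
    exact hxy (MulAction.injective g (h1.trans h2.symm))⟩

/-- The action of `G` on an orbital graph by automorphisms. -/
def orbitalGraphHom (x y : V) (hxy : x ≠ y) (hs : ∃ c : G, c • x = y ∧ c • y = x) :
    G →* (orbitalGraph G x y hxy hs ≃g orbitalGraph G x y hxy hs) where
  toFun g := ⟨MulAction.toPerm g, by
    intro u v
    constructor
    · rintro ⟨h, h1, h2⟩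
      refine ⟨g⁻¹ * h, ?_, ?_⟩
      · rw [mul_smul, h1, MulAction.toPerm_apply, inv_smul_smul]
      · rw [mul_smul, h2, MulAction.toPerm_apply, inv_smul_smul]
    · rintro ⟨h, rfl, rfl⟩
      exact ⟨g * h, mul_smul _ _ _, mul_smul _ _ _⟩⟩
  map_one' := by ext v; exact one_smul G v
  map_mul' g h := by ext v; exact mul_smul g h v

/-- Conditions under which `p : V → W` exhibits the orbital graph of `(x, y)` as a 2-arc-transitive
normal cover of `Δ` with transformation group the image of `ι`. -/
structure IsOrbitalCover (Δ : SimpleGraph W) (ι : T →* G) (p : V → W) (x y : V) : Prop where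
  swap : ∃ c : G, c • x = y ∧ c • y = x
  map_smul : ∀ (g : G) v, p (g • v) = g • p v
  adj_smul : ∀ (g : G) u v, Δ.Adj u v → Δ.Adj (g • u) (g • v)
  adj : Δ.Adj (p x) (p y)
  transitive : ∀ v, ∃ g : G, g • x = v
  normal : ι.range.Normal
  map_smul_fibre : ∀ t v, p (ι t • v) = p v
  exists_of_map_eq : ∀ u v, p u = p v → ∃ t, ι t • u = v
  free : ∀ t, ι t • x = x → t = 1
  local_injective : ∀ g : G, g • x = x → p (g • y) = p y → g • y = y
  local_surjective : ∀ w, Δ.Adj (p x) w → ∃ g : G, g • x = x ∧ g • p y = w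
  local_two_transitive : ∃ z, ∀ w w', Δ.Adj (p x) w → Δ.Adj (p x) w' → w ≠ w' →
    ∃ g : G, g • x = x ∧ g • p y = w ∧ g • z = w'

namespace IsOrbitalCover

variable {Δ : SimpleGraph W} {ι : T →* G} {p : V → W} {x y : V}

theorem ne (h : IsOrbitalCover Δ ι p x y) : x ≠ y := fun e => h.adj.ne (congrArg p e)

/-- The covering graph. -/
abbrev graph (h : IsOrbitalCover Δ ι p x y) : SimpleGraph V := orbitalGraph G x y h.ne h.swap

/-- The action of the group on the covering graph. -/
abbrev hom (h : IsOrbitalCover Δ ι p x y) : G →* (h.graph ≃g h.graph) :=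
  orbitalGraphHom x y h.ne h.swap

/-- The transformation group of the cover. -/
abbrev deckHom (h : IsOrbitalCover Δ ι p x y) : T →* h.hom.range := h.hom.rangeRestrict.comp ι

theorem map_adj (h : IsOrbitalCover Δ ι p x y) {u v : V} (huv : h.graph.Adj u v) :
    Δ.Adj (p u) (p v) := by
  obtain ⟨g, rfl, rfl⟩ := huv
  rw [h.map_smul, h.map_smul]
  exact h.adj_smul g _ _ h.adj

theorem smul_adj (h : IsOrbitalCover Δ ι p x y) (g : G) {u v : V} (huv : h.graph.Adj u v) :
    h.graph.Adj (g • u) (g • v) := (h.hom g).map_adj_iff.2 huv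

theorem eq_of_adj (h : IsOrbitalCover Δ ι p x y) {u v v' : V} (hv : h.graph.Adj u v)
    (hv' : h.graph.Adj u v') (e : p v = p v') : v = v' := by
  obtain ⟨g, rfl, rfl⟩ := hv
  obtain ⟨g', h1, rfl⟩ := hv'
  have := h.local_injective (g⁻¹ * g') (by rw [mul_smul, h1, inv_smul_smul])
    (by rw [mul_smul, h.map_smul, ← e, h.map_smul g, inv_smul_smul])
  rw [mul_smul, inv_smul_eq_iff] at this
  exact this.symm

theorem exists_adj (h : IsOrbitalCover Δ ι p x y) {u : V} {w : W} (hw : Δ.Adj (p u) w) :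
    ∃ v, h.graph.Adj u v ∧ p v = w := by
  obtain ⟨g, rfl⟩ := h.transitive u
  have := h.adj_smul g⁻¹ _ _ hw
  rw [h.map_smul, inv_smul_smul] at this
  obtain ⟨k, hk, hk'⟩ := h.local_surjective _ this
  refine ⟨(g * k) • y, ⟨g * k, by rw [mul_smul, hk], rfl⟩, ?_⟩
  rw [h.map_smul, mul_smul, hk', smul_inv_smul]

theorem exists_reachable (h : IsOrbitalCover Δ ι p x y) {w w' : W} (q : Δ.Walk w w') :
    ∀ u, p u = w → ∃ v, h.graph.Reachable u v ∧ p v = w' := by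
  induction q with
  | nil => exact fun u hu => ⟨u, Reachable.refl u, hu⟩
  | cons hadj _ ih =>
    rintro u rfl
    obtain ⟨v, huv, hv⟩ := h.exists_adj hadj
    obtain ⟨v', hv', e⟩ := ih v hv
    exact ⟨v', huv.reachable.trans hv', e⟩

theorem surjective (h : IsOrbitalCover Δ ι p x y) (hΔ : Δ.Preconnected) :
    Function.Surjective p := fun w =>
  have ⟨q⟩ := hΔ (p x) w
  have ⟨v, _, hv⟩ := h.exists_reachable q x rfl
  ⟨v, hv⟩

/-- The elements moving the base point within its connected component. -/
def componentStabilizer (h : IsOrbitalCover Δ ι p x y) : Subgroup G where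
  carrier := {g | h.graph.Reachable x (g • x)}
  one_mem' := by simp
  mul_mem' {g k} hg hk := by
    have := hk.map (h.hom g).toHom
    rw [Set.mem_ofPred_eq, mul_smul]
    exact hg.trans this
  inv_mem' {g} hg := by
    have := hg.map (h.hom g⁻¹).toHom
    change h.graph.Reachable (g⁻¹ • x) (g⁻¹ • g • x) at this
    rw [inv_smul_smul] at this
    exact this.symm

/-- Lifting a walk of the base joins any vertex to the fibre of `x`; the deck group is transitive on
that fibre and stays in one component. -/
theorem connected (h : IsOrbitalCover Δ ι p x y) (hΔ : Δ.Preconnected)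
    (hι : ι.range ≤ h.componentStabilizer) : h.graph.Connected := by
  have key : ∀ u, h.graph.Reachable x u := by
    intro u
    obtain ⟨q⟩ := hΔ (p u) (p x)
    obtain ⟨v, huv, hv⟩ := h.exists_reachable q u rfl
    obtain ⟨t, rfl⟩ := h.exists_of_map_eq x v hv.symm
    have ht : h.graph.Reachable x (ι t • x) := hι ⟨t, rfl⟩
    exact ht.trans huv.symm
  exact { preconnected := fun u v => (key u).symm.trans (key v), nonempty := ⟨x⟩ }

/-- Every 2-arc is moved onto a standard one centred at `x`. Only the projection of its last vertex
needs control, since a neighbour is determined by its image. -/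
theorem isSArcTransitive (h : IsOrbitalCover Δ ι p x y) :
    h.graph.IsSArcTransitive h.hom.range 2 := by
  obtain ⟨z, hz⟩ := h.local_two_transitive
  have key : ∀ a : Fin 3 → V, h.graph.IsSArc 2 a →
      ∃ g : G, g • x = a 1 ∧ g • y = a 0 ∧ g • z = p (a 2) := by
    intro a ha
    obtain ⟨k, hk⟩ := h.transitive (a 1)
    have h0 := h.smul_adj k⁻¹ (ha.1 0 1 rfl).symm
    have h2 := h.smul_adj k⁻¹ (ha.1 1 2 rfl)
    have hx : k⁻¹ • a 1 = x := by rw [← hk, inv_smul_smul]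
    rw [hx] at h0 h2
    obtain ⟨g, hg, hgy, hgz⟩ := hz _ _ (h.map_adj h0) (h.map_adj h2) fun e =>
      ha.2 0 2 rfl (MulAction.injective _ (h.eq_of_adj h0 h2 e))
    refine ⟨k * g, by rw [mul_smul, hg, hk], ?_, ?_⟩
    · rw [mul_smul, ← eq_inv_smul_iff]
      exact h.eq_of_adj ⟨g, hg, rfl⟩ h0 (by rw [h.map_smul, hgy])
    · rw [mul_smul, hgz, h.map_smul, smul_inv_smul]
  intro a b ha hb
  obtain ⟨g, g1, g0, g2⟩ := key a ha
  obtain ⟨k, k1, k0, k2⟩ := key b hb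
  have e1 : (k * g⁻¹) • a 1 = b 1 := by rw [← g1, mul_smul, inv_smul_smul, k1]
  refine ⟨h.hom (k * g⁻¹), ⟨_, rfl⟩, fun i => ?_⟩
  change (k * g⁻¹) • a i = b i
  match i with
  | 0 => rw [← g0, mul_smul, inv_smul_smul, k0]
  | 1 => exact e1
  | 2 =>
    have := h.smul_adj (k * g⁻¹) (ha.1 1 2 rfl)
    rw [e1] at this
    refine h.eq_of_adj this (hb.1 1 2 rfl) ?_
    rw [h.map_smul, ← g2, mul_smul, inv_smul_smul, k2]

theorem mem_orbit_iff (h : IsOrbitalCover Δ ι p x y) (u v : V) :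
    MulAction.orbitRel h.deckHom.range V u v ↔ p u = p v := by
  rw [MulAction.orbitRel_apply]
  constructor
  · rintro ⟨⟨_, t, rfl⟩, rfl⟩
    exact h.map_smul_fibre t v
  · intro e
    obtain ⟨t, rfl⟩ := h.exists_of_map_eq v u e.symm
    exact ⟨⟨_, t, rfl⟩, rfl⟩

/-- The vertices of the normal quotient are the vertices of the base graph. -/
noncomputable def quotientEquiv (h : IsOrbitalCover Δ ι p x y) (hΔ : Δ.Preconnected) :
    MulAction.orbitRel.Quotient h.deckHom.range V ≃ W :=
  Equiv.ofBijective
    (Quotient.lift p fun u v e => (h.mem_orbit_iff u v).1 e)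
    ⟨by
      rintro ⟨u⟩ ⟨v⟩ e
      exact Quotient.sound ((h.mem_orbit_iff u v).2 e),
    fun w => by
      obtain ⟨v, rfl⟩ := h.surjective hΔ w
      exact ⟨Quotient.mk _ v, rfl⟩⟩

theorem quotient_adj_iff (h : IsOrbitalCover Δ ι p x y) (u v : V) :
    (h.graph.normalQuotient h.deckHom.range).Adj (Quotient.mk _ u) (Quotient.mk _ v) ↔
      Δ.Adj (p u) (p v) := by
  constructor
  · rintro ⟨_, u', v', huv, hu, hv⟩
    rw [← (h.mem_orbit_iff u' u).1 (Quotient.exact hu),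
      ← (h.mem_orbit_iff v' v).1 (Quotient.exact hv)]
    exact h.map_adj huv
  · intro huv
    obtain ⟨v', hv', e⟩ := h.exists_adj huv
    exact ⟨fun e => huv.ne ((h.mem_orbit_iff u v).1 (Quotient.exact e)), u, v', hv', rfl,
      Quotient.sound ((h.mem_orbit_iff v' v).2 e)⟩

theorem isNormalCover (h : IsOrbitalCover Δ ι p x y) (hΔ : Δ.Preconnected)
    (hW : 3 ≤ ENat.card W) : h.graph.IsNormalCover Δ h.hom.range h.deckHom.range where
  normal := by
    rw [MonoidHom.range_comp]
    exact h.normal.map _ h.hom.rangeRestrict_surjective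
  three_le_orbits := hW.trans_eq (ENat.card_congr (h.quotientEquiv hΔ)).symm
  quotient_iso := ⟨⟨h.quotientEquiv hΔ, by
    rintro ⟨u⟩ ⟨v⟩
    exact (h.quotient_adj_iff u v).symm⟩⟩
  bijOn_neighborSet v := by
    refine ⟨fun u hu => (h.quotient_adj_iff v u).2 (h.map_adj hu), fun u hu u' hu' e =>
      h.eq_of_adj hu hu' ((h.mem_orbit_iff u u').1 (Quotient.exact e)), ?_⟩
    rintro ⟨w⟩ hw
    obtain ⟨v', hv', e⟩ := h.exists_adj ((h.quotient_adj_iff v w).1 hw)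
    exact ⟨v', hv', Quotient.sound ((h.mem_orbit_iff v' w).2 e)⟩

theorem isNonsolvableMinimalCover [IsSimpleGroup T] (h : IsOrbitalCover Δ ι p x y)
    (hΔ : Δ.Preconnected) (hW : 3 ≤ ENat.card W) (hT : ¬ Group.IsSolvable T) :
    h.graph.IsNonsolvableMinimalCover Δ 2 := by
  -- The deck group acts freely at `x`, hence faithfully, so it is a copy of `T`.
  have hinj : Function.Injective h.deckHom := by
    rw [injective_iff_map_eq_one]
    intro t ht
    exact h.free t (DFunLike.congr_fun (congrArg Subtype.val ht) x)
  refine ⟨h.hom.range, h.deckHom.range, h.isSArcTransitive, h.isNormalCover hΔ hW,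
    MonoidHom.range_isMinimalNormal _ (h.isNormalCover hΔ hW).normal hinj, fun hs => hT ?_⟩
  exact Group.isSolvable_of_isSolvable_injective (f := h.deckHom.rangeRestrict)
    (h.deckHom.rangeRestrict_injective_iff.2 hinj)

end IsOrbitalCover

end SimpleGraph

/-- These are the Coxeter relations of S₃; the six words are closed under right multiplication by
either generator. -/
theorem Subgroup.mem_closure_pair_of_braid {X : Type*} [Group X] {a b : X} (ha : a * a = 1)
    (hb : b * b = 1) (hab : b * a * b = a * b * a) {g : X} (hg : g ∈ Subgroup.closure {a, b}) :
    g = 1 ∨ g = a ∨ g = b ∨ g = a * b ∨ g = b * a ∨ g = a * b * a := by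
  have ha' : a⁻¹ = a := inv_eq_of_mul_eq_one_left ha
  have hb' : b⁻¹ = b := inv_eq_of_mul_eq_one_left hb
  have key : ∀ z : X, (z = 1 ∨ z = a ∨ z = b ∨ z = a * b ∨ z = b * a ∨ z = a * b * a) →
      ∀ s ∈ ({a, b} : Set X), (z * s = 1 ∨ z * s = a ∨ z * s = b ∨ z * s = a * b ∨
        z * s = b * a ∨ z * s = a * b * a) := by
    have hbab : a * b * a * b = b * a := by
      rw [mul_assoc, mul_assoc, ← mul_assoc b, hab, ← mul_assoc, ← mul_assoc, ha, one_mul]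
    have haa (x : X) : x * a * a = x := by rw [mul_assoc, ha, mul_one]
    have hbb (x : X) : x * b * b = x := by rw [mul_assoc, hb, mul_one]
    intro z hz s hs
    rw [Set.mem_insert_iff, Set.mem_singleton_iff] at hs
    rcases hz with rfl | rfl | rfl | rfl | rfl | rfl <;> rcases hs with hs | hs <;> simp [*]
  induction hg using Subgroup.closure_induction_right with
  | one => exact Or.inl rfl
  | mul_right z _ s hs ih => exact key z ih s hs
  | mul_inv_cancel z _ s hs ih =>
    have : s⁻¹ = s := by rcases hs with rfl | rfl <;> assumption
    exact this.symm ▸ key z ih s hs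

/-- The vertices of the Petersen graph. -/
abbrev PetersenVertex : Type := {a : Finset (Fin 5) // a.card = 2}

/-! ### The action of A₅ on the Petersen graph -/

namespace PetersenVertex

instance : MulAction (alternatingGroup (Fin 5)) PetersenVertex where
  smul g a := ⟨a.1.map g.1.toEmbedding, by rw [Finset.card_map, a.2]⟩
  one_smul a := Subtype.ext (Finset.map_refl)
  mul_smul g h a := Subtype.ext (Finset.map_map h.1.toEmbedding g.1.toEmbedding a.1).symm

/-- The action of a direct product through its second factor. -/
instance (T : Type*) [Group T] : MulAction (T × alternatingGroup (Fin 5)) PetersenVertex :=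
  MulAction.compHom _ (MonoidHom.snd T _)

theorem smul_adj (g : alternatingGroup (Fin 5)) (u v : PetersenVertex)
    (h : petersenGraph.Adj u v) : petersenGraph.Adj (g • u) (g • v) :=
  (Finset.disjoint_map g.1.toEmbedding).2 h

instance : DecidableRel petersenGraph.Adj := fun a b =>
  inferInstanceAs (Decidable (Disjoint a.1 b.1))

/-- The base vertex. -/
def v01 : PetersenVertex := ⟨{0, 1}, rfl⟩

/-- A neighbour of the base vertex. -/
def v23 : PetersenVertex := ⟨{2, 3}, rfl⟩

/-- A neighbour of the base vertex. -/
def v34 : PetersenVertex := ⟨{3, 4}, rfl⟩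

/-- An involution fixing the base vertex. -/
def rotA : alternatingGroup (Fin 5) := ⟨Equiv.swap 0 1 * Equiv.swap 3 4,
  Equiv.Perm.mem_alternatingGroup.2 (by decide)⟩

/-- An involution fixing the base vertex and its neighbour `v23`. -/
def rotB : alternatingGroup (Fin 5) := ⟨Equiv.swap 0 1 * Equiv.swap 2 3,
  Equiv.Perm.mem_alternatingGroup.2 (by decide)⟩

/-- An involution interchanging the base vertex and its neighbour `v23`. -/
def rotC : alternatingGroup (Fin 5) := ⟨Equiv.swap 0 2 * Equiv.swap 1 3,
  Equiv.Perm.mem_alternatingGroup.2 (by decide)⟩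

theorem rotA_mul_self : rotA * rotA = 1 := by decide
theorem rotB_mul_self : rotB * rotB = 1 := by decide
theorem rotC_mul_self : rotC * rotC = 1 := by decide
theorem rot_braid : rotB * rotA * rotB = rotA * rotB * rotA := by decide
theorem rotB_mul_rotC : rotB * rotC = rotC * rotB := by decide
theorem rotA_mul_rotC_pow : (rotA * rotC) ^ 5 = 1 := by decide

theorem eq_of_smul_v01 : ∀ g : alternatingGroup (Fin 5), g • v01 = v01 →
    g = 1 ∨ g = rotA ∨ g = rotB ∨ g = rotA * rotB ∨ g = rotB * rotA ∨ g = rotA * rotB * rotA := by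
  decide +kernel

theorem exists_two_transitive : ∀ w w', petersenGraph.Adj v01 w → petersenGraph.Adj v01 w' →
    w ≠ w' → ∃ g : alternatingGroup (Fin 5), g • v01 = v01 ∧ g • v23 = w ∧ g • v34 = w' := by
  decide +kernel

theorem exists_adj_ne : ∀ w, petersenGraph.Adj v01 w →
    ∃ w', petersenGraph.Adj v01 w' ∧ w ≠ w' := by
  decide +kernel

theorem petersenGraph_preconnected : petersenGraph.Preconnected := by
  have h : ∀ u v : PetersenVertex, u = v ∨ petersenGraph.Adj u v ∨
      ∃ w, petersenGraph.Adj u w ∧ petersenGraph.Adj w v := by decide +kernel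
  intro u v
  rcases h u v with rfl | h | ⟨w, h1, h2⟩
  · exact SimpleGraph.Reachable.refl u
  · exact h.reachable
  · exact h1.reachable.trans h2.reachable

theorem three_le_card : 3 ≤ ENat.card PetersenVertex := by
  rw [ENat.card_eq_coe_fintype_card, show Fintype.card PetersenVertex = 10 by decide +kernel]
  norm_num

end PetersenVertex

open PetersenVertex SimpleGraph

universe u

/-! ### Covers from three involutions in a simple group -/

section

variable {T : Type u} [Group T]

/-- The vertex stabilizer of the covering graph, a lift of the stabilizer of `v01`. -/
def petersenVertexGroup (a b : T) : Subgroup (T × alternatingGroup (Fin 5)) :=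
  Subgroup.closure {(a, rotA), (b, rotB)}

theorem smul_v01_of_mem_petersenVertexGroup {a b : T} {g : T × alternatingGroup (Fin 5)}
    (hg : g ∈ petersenVertexGroup a b) : g • v01 = v01 := by
  have : petersenVertexGroup a b ≤ MulAction.stabilizer _ v01 := by
    rw [petersenVertexGroup, Subgroup.closure_le]
    rintro _ (rfl | rfl)
    · exact (by decide : rotA • v01 = v01)
    · exact (by decide : rotB • v01 = v01)
  exact this hg

theorem exists_mem_petersenVertexGroup (a b : T) {g : alternatingGroup (Fin 5)}
    (hg : g • v01 = v01) : ∃ l ∈ petersenVertexGroup a b, l.2 = g := by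
  have ha : (a, rotA) ∈ petersenVertexGroup a b := Subgroup.subset_closure (Or.inl rfl)
  have hb : (b, rotB) ∈ petersenVertexGroup a b := Subgroup.subset_closure (Or.inr rfl)
  rcases eq_of_smul_v01 g hg with rfl | rfl | rfl | rfl | rfl | rfl
  · exact ⟨1, one_mem _, rfl⟩
  · exact ⟨_, ha, rfl⟩
  · exact ⟨_, hb, rfl⟩
  · exact ⟨_, mul_mem ha hb, rfl⟩
  · exact ⟨_, mul_mem hb ha, rfl⟩
  · exact ⟨_, mul_mem (mul_mem ha hb) ha, rfl⟩

theorem mem_petersenVertexGroup {a b : T} (ha : a * a = 1) (hb : b * b = 1)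
    (hab : b * a * b = a * b * a) {g : T × alternatingGroup (Fin 5)}
    (hg : g ∈ petersenVertexGroup a b) :
    g = 1 ∨ g = (a, rotA) ∨ g = (b, rotB) ∨ g = (a * b, rotA * rotB) ∨ g = (b * a, rotB * rotA) ∨
      g = (a * b * a, rotA * rotB * rotA) :=
  Subgroup.mem_closure_pair_of_braid (Prod.ext ha rotA_mul_self) (Prod.ext hb rotB_mul_self)
    (Prod.ext hab rot_braid) hg

/-- The projection of the covering graph to the Petersen graph. -/
def petersenProj (a b : T) : (T × alternatingGroup (Fin 5)) ⧸ petersenVertexGroup a b →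
    PetersenVertex :=
  Quotient.lift (fun g => g • v01) fun g h e => by
    have := smul_v01_of_mem_petersenVertexGroup (QuotientGroup.leftRel_apply.1 e)
    rw [mul_smul, inv_smul_eq_iff] at this
    exact this.symm

theorem smul_mk_one_eq_iff {G : Type*} [Group G] {L : Subgroup G} {g : G} :
    g • ((1 : G) : G ⧸ L) = ((1 : G) : G ⧸ L) ↔ g ∈ L := by
  rw [MulAction.Quotient.smul_coe, smul_eq_mul, mul_one, eq_comm, QuotientGroup.eq, inv_one,
    one_mul]

theorem isOrbitalCover_petersen {a b c : T} (ha : a * a = 1) (hb : b * b = 1) (hc : c * c = 1)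
    (hab : b * a * b = a * b * a) (hbc : b * c = c * b) :
    IsOrbitalCover petersenGraph (MonoidHom.inl T (alternatingGroup (Fin 5))) (petersenProj a b)
      ((1 : T × alternatingGroup (Fin 5)) : _ ⧸ petersenVertexGroup a b)
      (((c, rotC) : T × alternatingGroup (Fin 5)) : _ ⧸ petersenVertexGroup a b) where
  swap := ⟨(c, rotC), congrArg _ (mul_one _),
    congrArg _ (Prod.ext hc rotC_mul_self : (c, rotC) * (c, rotC) = 1)⟩
  map_smul := by
    rintro g ⟨h⟩
    exact mul_smul g h v01
  adj_smul g := smul_adj g.2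
  adj := by
    change petersenGraph.Adj v01 (rotC • v01)
    decide
  transitive := by
    rintro ⟨g⟩
    exact ⟨g, congrArg _ (mul_one _)⟩
  normal := by
    refine ⟨?_⟩
    rintro _ ⟨t, rfl⟩ g
    exact ⟨g.1 * t * g.1⁻¹, Prod.ext rfl (by simp)⟩
  map_smul_fibre := by
    rintro t ⟨h⟩
    exact congrArg (fun k : alternatingGroup (Fin 5) => k • v01) (one_mul h.2)
  exists_of_map_eq := by
    rintro ⟨g⟩ ⟨h⟩ e
    change g.2 • v01 = h.2 • v01 at e
    obtain ⟨l, hl, e⟩ := exists_mem_petersenVertexGroup a b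
      (g := g.2⁻¹ * h.2) (by rw [mul_smul, ← e, inv_smul_smul])
    -- Obtained by solving `g.1⁻¹ * t⁻¹ * h.1 = l.1` for `t`.
    refine ⟨h.1 * l.1⁻¹ * g.1⁻¹, QuotientGroup.eq.2 ?_⟩
    convert hl using 1
    ext1 <;> simp [mul_assoc, e]
  free := by
    intro t ht
    rw [smul_mk_one_eq_iff] at ht
    rcases mem_petersenVertexGroup ha hb hab ht with h | h | h | h | h | h
    · exact congrArg Prod.fst h
    all_goals
      refine absurd (congrArg Prod.snd h) ?_
      change ¬(1 : alternatingGroup (Fin 5)) = _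
      dsimp only
      decide
  local_injective := by
    intro g hg e
    rw [smul_mk_one_eq_iff] at hg
    change (g.2 * rotC) • v01 = rotC • v01 at e
    rcases mem_petersenVertexGroup ha hb hab hg with rfl | rfl | rfl | rfl | rfl | rfl
    · exact one_smul _ _
    -- Only 1 and `rotB` fix `v23`; the lift of `rotB` fixes `y` because it commutes with `(c,
    -- rotC)`. The other four words move `v23`.
    rotate_left
    · have hbc' : ((b, rotB) : T × alternatingGroup (Fin 5)) * (c, rotC) = (c, rotC) * (b, rotB) :=
        Prod.ext hbc rotB_mul_rotC
      rw [MulAction.Quotient.smul_coe, smul_eq_mul, hbc']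
      refine (QuotientGroup.eq.2 ?_).symm
      rw [inv_mul_cancel_left]
      exact Subgroup.subset_closure (Or.inr rfl)
    all_goals
      refine absurd e ?_
      dsimp only
      decide
  local_surjective := by
    intro w hw
    obtain ⟨w', hw', hne⟩ := exists_adj_ne w hw
    obtain ⟨g, hg, h1, -⟩ := exists_two_transitive w w' hw hw' hne
    obtain ⟨l, hl, rfl⟩ := exists_mem_petersenVertexGroup a b hg
    exact ⟨l, smul_mk_one_eq_iff.2 hl, h1⟩
  local_two_transitive := by
    refine ⟨v34, fun w w' hw hw' hne => ?_⟩
    obtain ⟨g, hg, h1, h2⟩ := exists_two_transitive w w' hw hw' hne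
    obtain ⟨l, hl, rfl⟩ := exists_mem_petersenVertexGroup a b hg
    exact ⟨l, smul_mk_one_eq_iff.2 hl, h1, h2⟩

/-- `hgen` is applied to the elements of `T` preserving the component of the base vertex; freeness
of `T` bounds the order of the graph below. -/
theorem exists_cover_of_simple [Finite T] [IsSimpleGroup T] (hT : ¬ Group.IsSolvable T)
    {a b c : T} (ha : a * a = 1) (hb : b * b = 1) (hc : c * c = 1)
    (hab : b * a * b = a * b * a) (hbc : b * c = c * b)
    (hgen : ∀ K : Subgroup T, (a * c) ^ 5 ∈ K → (∀ t ∈ K, b * t * b ∈ K) → K = ⊤) :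
    ∃ (V : Type u) (Γ : SimpleGraph V), (Finite V ∧ Γ.Connected ∧
      Γ.IsNonsolvableMinimalCover petersenGraph 2) ∧ Nat.card T ≤ Nat.card V := by
  have h := isOrbitalCover_petersen ha hb hc hab hbc
  refine ⟨_, h.graph, ⟨inferInstance, h.connected petersenGraph_preconnected ?_,
    h.isNonsolvableMinimalCover petersenGraph_preconnected three_le_card hT⟩, ?_⟩
  · have hA : (a, rotA) ∈ h.componentStabilizer := by
      have hx : (a, rotA) ∈ petersenVertexGroup a b := Subgroup.subset_closure (Or.inl rfl)
      change h.graph.Reachable _ _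
      rw [smul_mk_one_eq_iff.2 hx]
    have hB : (b, rotB) ∈ h.componentStabilizer := by
      have hx : (b, rotB) ∈ petersenVertexGroup a b := Subgroup.subset_closure (Or.inr rfl)
      change h.graph.Reachable _ _
      rw [smul_mk_one_eq_iff.2 hx]
    have hC : (c, rotC) ∈ h.componentStabilizer :=
      Adj.reachable ⟨1, one_smul _ _, (one_smul _ _).trans (congrArg _ (mul_one _)).symm⟩
    have hK := hgen (h.componentStabilizer.comap (MonoidHom.inl T _)) (by
      have := pow_mem (mul_mem hA hC) 5
      rw [Prod.mk_mul_mk, Prod.pow_mk, rotA_mul_rotC_pow] at this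
      exact this) (fun t ht => by
      have := mul_mem (mul_mem hB ht) hB
      rwa [MonoidHom.inl_apply, Prod.mk_mul_mk, Prod.mk_mul_mk, mul_one, rotB_mul_self] at this)
    rintro _ ⟨t, rfl⟩
    exact Subgroup.mem_comap.1 (hK ▸ Subgroup.mem_top t)
  · refine Nat.card_le_card_of_injective (fun t : T => MonoidHom.inl T (alternatingGroup (Fin 5)) t •
      ((1 : T × alternatingGroup (Fin 5)) : _ ⧸ petersenVertexGroup a b)) fun s t e => ?_
    have := h.free (t⁻¹ * s) (by
      rw [map_mul, mul_smul, map_inv]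
      exact inv_smul_eq_iff.2 e)
    exact (inv_mul_eq_one.1 this).symm

end

/-! ### Suitable involutions in PSL(2, p) -/

open Matrix MatrixGroups Matrix.SpecialLinearGroup

variable {F : Type*} [Field F]

theorem Matrix.ProjectiveSpecialLinearGroup.mk_eq_mk_of_neg {A B : SL(2, F)}
    (h : (A : Matrix (Fin 2) (Fin 2) F) = -B) : (A : PSL(2, F)) = B := by
  rw [QuotientGroup.eq, SpecialLinearGroup.mem_center_iff]
  refine ⟨-1, by simp, ?_⟩
  have hA : A = -B := Subtype.ext h
  rw [hA]
  ext i j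
  fin_cases i <;> fin_cases j <;> simp

theorem SL2_transvections_eq_top (K : Subgroup PSL(2, F))
    (h0 : ∀ x : F, (transvection zero_ne_one x : SL(2, F)) ∈ K.comap (QuotientGroup.mk' _))
    (h1 : ∀ x : F, (transvection one_ne_zero x : SL(2, F)) ∈ K.comap (QuotientGroup.mk' _)) :
    K = ⊤ := by
  rw [eq_top_iff]
  rintro ⟨A⟩ -
  change A ∈ K.comap (QuotientGroup.mk' _)
  refine SL2.transvection_induction (· ∈ K.comap (QuotientGroup.mk' _)) ?_
    (fun _ _ => mul_mem) A
  intro i j hij x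
  fin_cases i <;> fin_cases j
  · exact absurd rfl hij
  · exact h0 x
  · exact h1 x
  · exact absurd rfl hij

theorem transvection_pow {ι : Type*} [DecidableEq ι] [Fintype ι] {i j : ι} (hij : i ≠ j) (x : F)
    (n : ℕ) : (transvection hij x) ^ n = transvection hij (n * x) := by
  induction n with
  | zero => simp
  | succ n ih => rw [pow_succ, ih, ← transvection_add]; congr 1; push_cast; ring

theorem exists_petersen_cover_of_field {F : Type u} [Field F] [Finite F] {i : F} (hi : i * i = -1)
    (h2 : (2 : F) ≠ 0) (h3 : (3 : F) ≠ 0) (h5 : (5 : F) ≠ 0) (hF : ∀ x : F, ∃ n : ℕ, (n : F) = x) :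
    ∃ (V : Type u) (Γ : SimpleGraph V), (Finite V ∧ Γ.Connected ∧
      Γ.IsNonsolvableMinimalCover petersenGraph 2) ∧ Nat.card F ≤ Nat.card V := by
  have hF3 : ∃ a : F, a ≠ 0 ∧ a ^ 2 ≠ 1 := ⟨2, h2, fun h => h3 (by linear_combination h)⟩
  have : IsSimpleGroup PSL(2, F) := ProjectiveSpecialLinearGroup.rank_two_simple' hF3
  have hT : ¬ Group.IsSolvable PSL(2, F) := fun _ =>
    (Group.IsSolvable.commutator_lt_top_of_nontrivial PSL(2, F)).ne
      (SL2Simple.PSL_commutator_eq_top hF3)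
  obtain ⟨A, hA⟩ : ∃ A : SL(2, F), (A : Matrix (Fin 2) (Fin 2) F) = !![i, i; 0, -i] :=
    ⟨⟨_, by rw [det_fin_two_of]; linear_combination -hi⟩, rfl⟩
  obtain ⟨B, hB⟩ : ∃ B : SL(2, F), (B : Matrix (Fin 2) (Fin 2) F) = !![0, i; i, 0] :=
    ⟨⟨_, by rw [det_fin_two_of]; linear_combination -hi⟩, rfl⟩
  obtain ⟨C, hC⟩ : ∃ C : SL(2, F), (C : Matrix (Fin 2) (Fin 2) F) = !![i, 0; 0, -i] :=
    ⟨⟨_, by rw [det_fin_two_of]; linear_combination -hi⟩, rfl⟩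
  -- Each relation holds in SL(2, F) up to the sign -1, which vanishes in the quotient.
  have hAA : (A : PSL(2, F)) * A = 1 :=
    ProjectiveSpecialLinearGroup.mk_eq_mk_of_neg (A := A * A) (B := 1) (by
      ext r s; fin_cases r <;> fin_cases s <;> simp [hA, hi])
  have hBB : (B : PSL(2, F)) * B = 1 :=
    ProjectiveSpecialLinearGroup.mk_eq_mk_of_neg (A := B * B) (B := 1) (by
      ext r s; fin_cases r <;> fin_cases s <;> simp [hB, hi])
  have hCC : (C : PSL(2, F)) * C = 1 :=
    ProjectiveSpecialLinearGroup.mk_eq_mk_of_neg (A := C * C) (B := 1) (by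
      ext r s; fin_cases r <;> fin_cases s <;> simp [hC, hi])
  have hBAB : (B : PSL(2, F)) * A * B = A * B * A :=
    ProjectiveSpecialLinearGroup.mk_eq_mk_of_neg (A := B * A * B) (B := A * B * A) (by
      ext r s; fin_cases r <;> fin_cases s <;> simp [hA, hB])
  have hBC : (B : PSL(2, F)) * C = C * B :=
    ProjectiveSpecialLinearGroup.mk_eq_mk_of_neg (A := B * C) (B := C * B) (by
      ext r s; fin_cases r <;> fin_cases s <;> simp [hB, hC])
  have hAC : (A : PSL(2, F)) * C = (transvection zero_ne_one (-1) : SL(2, F)) :=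
    ProjectiveSpecialLinearGroup.mk_eq_mk_of_neg (A := A * C) (by
      ext r s; fin_cases r <;> fin_cases s <;> simp [hA, hC, transvection_coe, hi])
  have hBtB (x : F) : (B : PSL(2, F)) * (transvection zero_ne_one x : SL(2, F)) * B =
      (transvection one_ne_zero x : SL(2, F)) := by
    refine ProjectiveSpecialLinearGroup.mk_eq_mk_of_neg (A := B * transvection zero_ne_one x * B) ?_
    have hU : ((transvection zero_ne_one x : SL(2, F)) : Matrix (Fin 2) (Fin 2) F) =
        !![1, x; 0, 1] := by
      ext r s; fin_cases r <;> fin_cases s <;> simp [transvection_coe]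
    rw [coe_mul, coe_mul, hU, hB]
    ext r s; fin_cases r <;> fin_cases s <;>
      simp [transvection_coe, hi, mul_right_comm i x i]
  have hinj : Function.Injective
      (fun x : F => ((transvection zero_ne_one x : SL(2, F)) : PSL(2, F))) := by
    intro x y e
    have := QuotientGroup.eq.1 e
    rw [transvection_inv, ← transvection_add, transvection_mem_center_iff] at this
    linear_combination -this
  obtain ⟨V, Γ, hΓ, hc⟩ := exists_cover_of_simple hT hAA hBB hCC hBAB hBC fun K hK hconj => by
    have h0 (x : F) : ((transvection zero_ne_one x : SL(2, F)) : PSL(2, F)) ∈ K := by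
      -- The fifth power of `A * C` is the transvection with parameter -5, so over a prime field its
      -- powers give every parameter `x`.
      obtain ⟨n, hn⟩ := hF (-x / 5)
      have := pow_mem hK n
      rw [hAC, ← pow_mul, ← QuotientGroup.mk_pow, transvection_pow] at this
      convert this using 4
      push_cast
      rw [hn]
      field_simp
    exact SL2_transvections_eq_top K h0 fun x => by
      have := hconj _ (h0 x)
      rwa [hBtB] at this
  exact ⟨V, Γ, hΓ, (Nat.card_le_card_of_injective _ hinj).trans hc⟩

theorem exists_petersen_cover (p : ℕ) [Fact p.Prime] (hp : p % 4 = 1) (hp5 : 5 < p) :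
    ∃ (V : Type) (Γ : SimpleGraph V), (Finite V ∧ Γ.Connected ∧
      Γ.IsNonsolvableMinimalCover petersenGraph 2) ∧ p ≤ Nat.card V := by
  obtain ⟨i, hi⟩ := ZMod.exists_sq_eq_neg_one_iff.2 (show p % 4 ≠ 3 by omega)
  have hne (n : ℕ) (hn : 0 < n) (hn5 : n ≤ 5) : (n : ZMod p) ≠ 0 := fun h =>
    absurd (Nat.le_of_dvd hn ((ZMod.natCast_eq_zero_iff n p).1 h)) (by omega)
  obtain ⟨V, Γ, h, hc⟩ := exists_petersen_cover_of_field hi.symm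
    (by exact_mod_cast hne 2 (by norm_num) (by norm_num))
    (by exact_mod_cast hne 3 (by norm_num) (by norm_num))
    (by exact_mod_cast hne 5 (by norm_num) (by norm_num))
    fun x => ⟨x.val, ZMod.natCast_zmod_val x⟩
  exact ⟨V, Γ, h, (Nat.card_zmod p).symm.trans_le hc⟩

/-- There are infinitely many pairwise non-isomorphic finite connected 2-arc-transitive non-solvable
minimal covers of the Petersen graph. -/
theorem corollary1p3 :
    ∃ (V : ℕ → Type) (Γ : ∀ i, SimpleGraph (V i)),
      (∀ i, Finite (V i) ∧ (Γ i).Connected ∧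
        (Γ i).IsNonsolvableMinimalCover petersenGraph 2) ∧
      ∀ i j, i ≠ j → IsEmpty (Γ i ≃g Γ j) := by
  let S : Set ℕ := {n | ∃ (V : Type) (Γ : SimpleGraph V), (Finite V ∧ Γ.Connected ∧
    Γ.IsNonsolvableMinimalCover petersenGraph 2) ∧ Nat.card V = n}
  have hS : S.Infinite := by
    refine Set.infinite_of_forall_exists_gt fun n => ?_
    -- The bound `n + 5` secures both `p > 5` and an order exceeding `n`.
    obtain ⟨p, hp, hn, h1⟩ := Nat.exists_prime_gt_modEq_one (k := 4) (n + 5) (by norm_num)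
    have : Fact p.Prime := ⟨hp⟩
    obtain ⟨V, Γ, h, hc⟩ := exists_petersen_cover p h1 (by omega)
    exact ⟨_, ⟨V, Γ, h, rfl⟩, by omega⟩
  choose V Γ hΓ hcard using fun i => (hS.natEmbedding S i).2
  refine ⟨V, Γ, hΓ, fun i j hij => ⟨fun e => hij ?_⟩⟩
  have := Nat.card_congr e.toEquiv
  rw [hcard, hcard] at this
  exact (hS.natEmbedding S).injective (Subtype.ext this)
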